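/- **Proposition 5.3.** Consider the independent two-group model with parameter $\theta=(\pi_0,F_0,F_1)$: $H_1,\dots,H_m$ are i.i.d. Bernoulli with $\mathbb P(H_i=1)=1-\pi_0$ and, conditionally on $(H_i)_i$, the $p$-values $p_1,\dots,p_m\in[0,1]$ are independent with $p_i\sim F_0$ if $H_i=0$ and $p_i\sim F_1$ if $H_i=1$. Here $F_0,F_1$ are continuous distribution functions of probability laws on $[0,1]$; write $F=\pi_0F_0+(1-\pi_0)F_1$ and $\mathbb P_\theta$ for the probability. Let $\Theta_{\succeq U}$ be the set of such $\theta$ with $\pi_0\in(0,1]$, $F_0(x)\le x$ for all $x\in[0,1]$, and such that $F$ has a Lipschitz density on $[0,1]$. For $\theta\in\Theta_{\succeq U}$ put $$\pi_0^*(\theta)=\inf_{\lambda\in[0,1)}\frac{1-F(\lambda)}{1-\lambda}.$$ For an integer $s\ge1$ and $\epsilon>0$ let $$c(s,\epsilon)=\mathbb E\Big[1\vee\max_{\lambda\in\{q_1,\dots,q_s\}\cap(0,1-\epsilon)}\frac{s(1-\lambda)}{1\vee\sum_{i=1}^s\mathbf 1\{q_i>\lambda\}}\Big],$$ where $q_1=0$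 and $q_2,\dots,q_s$ are i.i.d. uniform on $(0,1)$ (a maximum over the empty set is omitted), let $C(m,\epsilon,\underline\pi_0)=\max\{c(s,\epsilon): s\in\{1,\dots,m\},\ \underline\pi_0m\le s\le m\}$, and define the Minimum-Storey (MS) estimator $$\hat\pi^{\mathrm{MS}}_{0,\epsilon,\underline\pi_0}=\underline\pi_0\vee\Big(C(m,\epsilon,\underline\pi_0)\inf_{\lambda\in[0,1-\epsilon]}\frac{1\vee\sum_{i=1}^m\mathbf 1\{p_i\ge\lambda\}}{m(1-\lambda)}\Big).$$ Take $\epsilon=\epsilon_m=m^{-1/4}$, and let $\underline\pi_0=\underline\pi_{0,m}$ be any sequence with $\underline\pi_{0,m}\to0$ as $m\to\infty$ and $\underline\pi_{0,m}\ge\frac12\wedge\frac{162}{\log m}$ for all large $m$. Then for every $\theta\in\Theta_{\succeq U}$ there is $m_0$ (depending on $\theta$ and on the sequence $(\underline\pi_{0,m})_m$) such that for all $m\ge m_0$, $$\mathbb P_\theta\Big(\hat\pi^{\mathrm{MS}}_{0,\epsilon,\underline\pi_0}\ge\pi_0^*(\theta)+4\,\frac{\sqrt{\log m}}{m^{1/4}}\Big)\le\frac1m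 .$$ -/

import Mathlib

open MeasureTheory ProbabilityTheory Filter Topology

noncomputable section

/-- A parameter `(pi0, F0, F1)` of the independent two-group model: the null proportion, the null
distribution and the alternative distribution of a p-value. The distribution functions `F0`, `F1`
are the `cdf`s of the two probability measures. -/
structure TwoGroupParam where
  pi0 : ℝ
  nullLaw : ProbabilityMeasure ℝ
  altLaw : ProbabilityMeasure ℝ

namespace TwoGroupParam

/-- The distribution function `F0`. -/
def F0 (θ : TwoGroupParam) (x : ℝ) : ℝ := cdf (θ.nullLaw : Measure ℝ) x

/-- The distribution function `F1`. -/
def F1 (θ : TwoGroupParam) (x : ℝ) : ℝ := cdf (θ.altLaw : Measure ℝ) x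

/-- The distribution function `F = pi0 F0 + (1 - pi0) F1` of the mixture. -/
def F (θ : TwoGroupParam) (x : ℝ) : ℝ := θ.pi0 * θ.F0 x + (1 - θ.pi0) * θ.F1 x

/-- The parameter set of the model with a super-uniform null: `pi0 ∈ (0,1]`, p-values take
values in `[0,1]`, `F0` and `F1` are continuous, `F0 x ≤ x` on `[0,1]`, and the mixture `F` has a
density that is Lipschitz on `[0,1]`. -/
structure MemThetaSuperUnif (θ : TwoGroupParam) : Prop where
  pi0_pos : 0 < θ.pi0
  pi0_le_one : θ.pi0 ≤ 1
  null_supp : (θ.nullLaw : Measure ℝ) (Set.Icc 0 1) = 1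
  alt_supp : (θ.altLaw : Measure ℝ) (Set.Icc 0 1) = 1
  null_cont : Continuous θ.F0
  alt_cont : Continuous θ.F1
  super_unif : ∀ x ∈ Set.Icc (0 : ℝ) 1, θ.F0 x ≤ x
  lipschitz_density : ∃ f : ℝ → ℝ, (∃ L : NNReal, LipschitzOnWith L f (Set.Icc 0 1)) ∧
    (∀ x ∈ Set.Icc (0 : ℝ) 1, 0 ≤ f x) ∧
    ∀ x ∈ Set.Icc (0 : ℝ) 1, θ.F x = ∫ t in (0 : ℝ)..x, f t

/-- The joint law of one pair `(H, p)`: `H` is `true` (alternative) with probability `1 - pi0` and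
`false` (null) with probability `pi0`; given `H`, the p-value `p` is drawn from the alternative
law if `H = true` and from the null law if `H = false`. -/
def pairLaw (θ : TwoGroupParam) : Measure (Bool × ℝ) :=
  ENNReal.ofReal θ.pi0 • (Measure.dirac false).prod (θ.nullLaw : Measure ℝ) +
    ENNReal.ofReal (1 - θ.pi0) • (Measure.dirac true).prod (θ.altLaw : Measure ℝ)

/-- The law of `(H_i, p_i)`, `i ∈ [m]`, in the independent two-group model: the pairs are iid. -/
def law (θ : TwoGroupParam) (m : ℕ) : Measure (Fin m → Bool × ℝ) :=
  Measure.pi fun _ => θ.pairLaw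

/-- The oracle null proportion `inf_{l ∈ [0,1)} (1 - F l) / (1 - l)`. -/
def pi0Star (θ : TwoGroupParam) : ℝ :=
  ⨅ l : Set.Ico (0 : ℝ) 1, (1 - θ.F l) / (1 - (l : ℝ))

end TwoGroupParam

/-- The least favorable distribution `δ_0 × U(0,1)^{⊗ (s-1)}` of `s` null p-values. -/
def leastFavorable (s : ℕ) : Measure (Fin s → ℝ) :=
  Measure.pi fun i => if (i : ℕ) = 0 then Measure.dirac 0 else volume.restrict (Set.Icc 0 1)

/-- The random variable under the expectation in `storeyFactor`: the maximum of `1` and of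
`s (1 - l) / (1 ∨ #{i : q i > l})` over the `l` in `{q 1, …, q s} ∩ (0, 1 - ε)`. (These quotients
are nonnegative, so an index with `q j ∉ (0, 1 - ε)` may contribute the value `0`.) -/
def storeyMax (s : ℕ) (ε : ℝ) (q : Fin s → ℝ) : ℝ :=
  max 1 (⨆ j : Fin s, if 0 < q j ∧ q j < 1 - ε then
    (s : ℝ) * (1 - q j) / max 1 (∑ i : Fin s, if q j < q i then (1 : ℝ) else 0) else 0)

/-- `c(s, ε)`, the expectation of `storeyMax` under the least favorable distribution. -/
def storeyFactor (s : ℕ) (ε : ℝ) : ℝ :=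
  ∫ q, storeyMax s ε q ∂(leastFavorable s)

/-- `C(m, ε, pilow)`, the maximum of `c(s, ε)` over the integers `s ∈ [m]` with
`pilow * m ≤ s ≤ m`. -/
def normFactor (m : ℕ) (ε pilow : ℝ) : ℝ :=
  sSup ((fun s : ℕ => storeyFactor s ε) '' {s : ℕ | 1 ≤ s ∧ pilow * m ≤ s ∧ s ≤ m})

/-- The Minimum-Storey estimator of the null proportion with parameters `ε` and `pilow`. -/
def msEstimator (m : ℕ) (ε pilow : ℝ) (p : Fin m → ℝ) : ℝ :=
  max pilow (normFactor m ε pilow *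
    ⨅ l : Set.Icc (0 : ℝ) (1 - ε),
      max 1 (∑ i : Fin m, if (l : ℝ) ≤ p i then (1 : ℝ) else 0) / (m * (1 - (l : ℝ))))

end

/-! An upper bound on the estimator needs only one good threshold, so no uniform empirical-process
bound is required. Write δ = m^(-1/4) and r = √(log m)·δ. The Lipschitz density supplies a
deterministic l ≤ 1 - δ whose quotient is within Kδ of the oracle (`exists_quotient_le`). Hoeffding
at this l with deviation rδ fails with probability at most m⁻² (`law_real_count_ge_le`); division by
1 - l ≥ δ turns that deviation into at most r.

The normalising factor is at most 1 + 5δ (`normFactor_le`): Chernoff bounds on a grid keep the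
uniform counts near their means, and rounding extends this to every threshold (`storeyFactor_le`).
All errors then fit into 4r, since √(log m) eventually exceeds K and 20 (`msEstimator_lt`). -/

/-! ### Lower-tail exponential moments of counts under the least favorable law. -/

instance isProbabilityMeasure_leastFavorable_marginal {s : ℕ} (i : Fin s) :
    IsProbabilityMeasure (if (i : ℕ) = 0 then Measure.dirac (0 : ℝ)
      else volume.restrict (Set.Icc 0 1)) := by
  split_ifs
  · infer_instance
  · exact ⟨by simp⟩

instance isProbabilityMeasure_leastFavorable (s : ℕ) :
    IsProbabilityMeasure (leastFavorable s) := by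
  unfold leastFavorable; infer_instance

/-- The number of coordinates of `q` above `l`. -/
noncomputable def countAbove {s : ℕ} (l : ℝ) (q : Fin s → ℝ) : ℝ := ∑ i, if l < q i then (1 : ℝ) else 0

lemma measurable_countAbove {s : ℕ} (l : ℝ) : Measurable (countAbove (s := s) l) := by
  refine Finset.measurable_sum _ fun i _ => Measurable.ite ?_ measurable_const measurable_const
  exact measurableSet_lt measurable_const (measurable_pi_apply i)

lemma countAbove_nonneg {s : ℕ} (l : ℝ) (q : Fin s → ℝ) : 0 ≤ countAbove l q :=
  Finset.sum_nonneg fun i _ => by split_ifs <;> norm_num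

lemma countAbove_anti {s : ℕ} {l l' : ℝ} (h : l ≤ l') (q : Fin s → ℝ) :
    countAbove l' q ≤ countAbove l q := by
  refine Finset.sum_le_sum fun i _ => ?_
  split_ifs <;> linarith

lemma exp_neg_le_quadratic {t : ℝ} (h0 : 0 ≤ t) (h1 : t ≤ 1) :
    Real.exp (-t) ≤ 1 - (t - t ^ 2) := by
  have := Real.abs_exp_sub_one_sub_id_le (x := -t) (by rw [abs_neg, abs_of_nonneg h0]; exact h1)
  have := (abs_le.1 this).2
  nlinarith

lemma integral_uniform_exp_neg_ite_le {t l : ℝ} (h0 : 0 ≤ t) (h1 : t ≤ 1) (hl0 : 0 < l)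
    (hl1 : l ≤ 1) :
    ∫ x, Real.exp (-t * if l < x then (1 : ℝ) else 0) ∂(volume.restrict (Set.Icc (0 : ℝ) 1)) ≤
      Real.exp (-((1 - l) * (t - t ^ 2))) := by
  have hI : Set.Ioi l ∩ Set.Icc (0 : ℝ) 1 = Set.Ioc l 1 := by
    ext x
    simp only [Set.mem_inter_iff, Set.mem_Ioi, Set.mem_Icc, Set.mem_Ioc]
    constructor
    · rintro ⟨h, -, h'⟩; exact ⟨h, h'⟩
    · rintro ⟨h, h'⟩; exact ⟨h, by linarith, h'⟩
  have hE : (fun x : ℝ => Real.exp (-t * if l < x then (1 : ℝ) else 0)) =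
      fun x => 1 - (Set.Ioi l).indicator (fun _ => 1 - Real.exp (-t)) x := by
    funext x
    by_cases hx : l < x <;> simp [hx]
  rw [hE, integral_sub (integrable_const _)
    ((integrable_const _).indicator measurableSet_Ioi), integral_indicator_const _ measurableSet_Ioi]
  have hv : (volume.restrict (Set.Icc (0 : ℝ) 1)).real (Set.Ioi l) = 1 - l := by
    rw [measureReal_restrict_apply measurableSet_Ioi, hI]
    simp [Real.volume_real_Ioc, hl1]
  rw [hv]
  have h2 := exp_neg_le_quadratic h0 h1
  have h3 : (1 - l) * (t - t ^ 2) ≤ (1 - l) * (1 - Real.exp (-t)) :=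
    mul_le_mul_of_nonneg_left (by linarith) (by linarith)
  have h4 := Real.add_one_le_exp (-((1 - l) * (t - t ^ 2)))
  simp only [integral_const, smul_eq_mul]
  simp
  linarith

lemma integral_exp_neg_countAbove_le (n : ℕ) {t l : ℝ} (h0 : 0 ≤ t) (h1 : t ≤ 1) (hl0 : 0 < l)
    (hl1 : l ≤ 1) :
    ∫ q, Real.exp (-t * countAbove l q) ∂(leastFavorable (n + 1)) ≤
      Real.exp (-(n * ((1 - l) * (t - t ^ 2)))) := by
  have hE : ∀ q : Fin (n + 1) → ℝ, Real.exp (-t * countAbove l q) =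
      ∏ i, Real.exp (-t * if l < q i then (1 : ℝ) else 0) := by
    intro q
    rw [countAbove, Finset.mul_sum, Real.exp_sum]
  simp_rw [hE]
  rw [leastFavorable, integral_fintype_prod_eq_prod
    (f := fun _ x => Real.exp (-t * if l < x then (1 : ℝ) else 0)), Fin.prod_univ_succ]
  -- The atom at 0 never exceeds l > 0, so only the n uniform coordinates contribute.
  have hz : ∫ x, Real.exp (-t * if l < x then (1 : ℝ) else 0)
      ∂(if ((0 : Fin (n + 1)) : ℕ) = 0 then Measure.dirac (0 : ℝ)
        else volume.restrict (Set.Icc 0 1)) = 1 := by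
    simp [not_lt.2 hl0.le]
  rw [hz, one_mul]
  calc _ ≤ ∏ _i : Fin n, Real.exp (-((1 - l) * (t - t ^ 2))) := by
        refine Finset.prod_le_prod (fun i _ => integral_nonneg fun x => (Real.exp_pos _).le)
          fun i _ => ?_
        simpa using integral_uniform_exp_neg_ite_le h0 h1 hl0 hl1
    _ = _ := by
        rw [Finset.prod_const, Finset.card_univ, Fintype.card_fin, ← Real.exp_nat_mul]
        congr 1; ring

/-! ### Bounding c(s, ε) by discretisation. -/

/-- A lower bound of the counts on the grid `k / M` controls `storeyMax`. -/
lemma storeyMax_le_of_grid {s M : ℕ} {ε η : ℝ} (hs : 2 ≤ s) (hη0 : 0 ≤ η) (hη1 : η < 1)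
    (hM : 0 < M) (hε : 0 < ε) (hMε : 1 / (M : ℝ) ≤ ε / 2) (q : Fin s → ℝ)
    (hq : ∀ k ∈ Finset.Icc 1 M, (k : ℝ) / M ≤ 1 - ε / 2 →
      (1 - η) * ((s - 1) * (1 - k / M)) ≤ countAbove (k / M : ℝ) q) :
    storeyMax s ε q ≤ 1 / ((1 - η) * (1 - 1 / s) * (1 - 1 / (M * ε))) := by
  have hM' : (0 : ℝ) < M := by exact_mod_cast hM
  have hs' : (2 : ℝ) ≤ s := by exact_mod_cast hs
  have hMε' : 1 / (M * ε) ≤ 1 / 2 := by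
    rw [div_le_iff₀ hM'] at hMε
    rw [div_le_div_iff₀ (by positivity) (by norm_num)]
    linarith
  have hMε0 : 0 < 1 / (M * ε) := by positivity
  have hs1 : 1 / (s : ℝ) ≤ 1 / 2 := one_div_le_one_div_of_le (by norm_num) hs'
  have hs0 : 0 < 1 / (s : ℝ) := by positivity
  set D := (1 - η) * (1 - 1 / s) * (1 - 1 / (M * ε)) with hD
  have hD0 : 0 < D := mul_pos (mul_pos (by linarith) (by linarith)) (by linarith)
  have hD1 : D ≤ 1 := mul_le_one₀ (mul_le_one₀ (by linarith) (by linarith) (by linarith))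
    (by linarith) (by linarith)
  have : Nonempty (Fin s) := ⟨⟨0, by omega⟩⟩
  refine max_le (by rw [le_div_iff₀ hD0]; linarith) (ciSup_le fun j => ?_)
  split_ifs with hj
  swap
  · positivity
  obtain ⟨hj0, hj1⟩ := hj
  -- Rounding up can only lower the count, so a lower bound at the grid point transfers to `q j`.
  set k := ⌈q j * M⌉₊ with hk
  have hkl : q j * M ≤ k := Nat.le_ceil _
  have hku : (k : ℝ) < q j * M + 1 := Nat.ceil_lt_add_one (by positivity)
  have hk1 : 1 ≤ k := Nat.one_le_iff_ne_zero.2 (Nat.ceil_pos.2 (by positivity)).ne'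
  have hkl' : q j ≤ k / M := by rw [le_div_iff₀ hM']; exact hkl
  have hku' : (k : ℝ) / M ≤ q j + 1 / M := by
    rw [div_le_iff₀ hM', add_mul, one_div_mul_cancel hM'.ne']; exact hku.le
  have hkε : (k : ℝ) / M ≤ 1 - ε / 2 := by linarith
  have hkM : k ≤ M := by
    have : (k : ℝ) / M ≤ 1 := by linarith
    rw [div_le_one hM'] at this
    exact_mod_cast this
  have h1 := (hq k (Finset.mem_Icc.2 ⟨hk1, hkM⟩) hkε).trans (countAbove_anti hkl' q)
  -- The rounding error 1/M is a small fraction of 1 - q j because 1 - q j > ε.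
  have hgap : (1 - q j) * (1 - 1 / (M * ε)) ≤ 1 - k / M := by
    have : 1 / (M : ℝ) ≤ (1 - q j) * (1 / (M * ε)) := by
      rw [mul_one_div, div_le_div_iff₀ hM' (by positivity)]
      nlinarith
    nlinarith
  have h2 : D * (s * (1 - q j)) ≤ countAbove (q j) q := by
    refine le_trans (le_of_eq_of_le ?_ (mul_le_mul_of_nonneg_left
      (mul_le_mul_of_nonneg_left hgap (by linarith : (0 : ℝ) ≤ s - 1))
      (by linarith : 0 ≤ 1 - η))) h1
    rw [hD]; field_simp
  rw [div_le_div_iff₀ (lt_of_lt_of_le one_pos (le_max_left _ _)) hD0, one_mul]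
  refine le_trans ?_ (le_max_right _ _)
  rw [countAbove] at h2
  linarith

lemma storeyMax_le_card {s : ℕ} {ε : ℝ} (hs : 1 ≤ s) (hε : 0 < ε) (q : Fin s → ℝ) :
    storeyMax s ε q ≤ s := by
  have hs' : (1 : ℝ) ≤ s := by exact_mod_cast hs
  have : Nonempty (Fin s) := ⟨⟨0, by omega⟩⟩
  refine max_le hs' (ciSup_le fun j => ?_)
  split_ifs with hj
  · refine (div_le_self (mul_nonneg (by linarith) (by linarith)) (le_max_left _ _)).trans ?_
    nlinarith [hj.1]
  · linarith

/-- If every grid count reaches 1 - η times its mean, the deterministic grid bound applies;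
otherwise the trivial bound s does. The indicator of the bad event is dominated by a sum of Chernoff
exponentials, which is then integrated. -/
lemma storeyFactor_le {s M : ℕ} {ε η : ℝ} (hs : 2 ≤ s) (hη0 : 0 ≤ η) (hη1 : η < 1)
    (hM : 0 < M) (hε : 0 < ε) (hMε : 1 / (M : ℝ) ≤ ε / 2) :
    storeyFactor s ε ≤ 1 / ((1 - η) * (1 - 1 / s) * (1 - 1 / (M * ε))) +
      s * (M * Real.exp (-((s - 1) * ε * η ^ 2 / 8))) := by
  obtain ⟨n, rfl⟩ : ∃ n, s = n + 1 := ⟨s - 1, by omega⟩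
  have hM' : (0 : ℝ) < M := by exact_mod_cast hM
  set B := 1 / ((1 - η) * (1 - 1 / ((n + 1 : ℕ) : ℝ)) * (1 - 1 / (M * ε))) with hB
  -- Minimises the Chernoff exponent, proportional to -ηt + t², with value -η²/4; the gap 1 - k/M ≥
  -- ε/2 then gives the 8.
  set t := η / 2 with ht
  set K := (Finset.Icc 1 M).filter fun k : ℕ => (k : ℝ) / M ≤ 1 - ε / 2 with hK
  set a : ℕ → ℝ := fun k => (1 - η) * ((((n + 1 : ℕ) : ℝ) - 1) * (1 - k / M)) with ha
  set e : ℕ → (Fin (n + 1) → ℝ) → ℝ := fun k q =>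
    Real.exp (t * a k) * Real.exp (-t * countAbove (k / M : ℝ) q) with he
  have he0 : ∀ k q, 0 ≤ e k q := fun k q => mul_nonneg (Real.exp_pos _).le (Real.exp_pos _).le
  have hB0 : 0 ≤ B := by
    have h1 : 1 / (((n + 1 : ℕ) : ℝ)) ≤ 1 := by
      rw [div_le_one (by positivity)]; push_cast; linarith [Nat.cast_nonneg (α := ℝ) n]
    have h2 : 1 / (M * ε) ≤ 1 := by
      rw [div_le_one (by positivity)]
      rw [div_le_iff₀ hM'] at hMε
      linarith
    exact one_div_nonneg.2
      (mul_nonneg (mul_nonneg (by linarith) (by linarith)) (by linarith))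
  have hle : ∀ q, storeyMax (n + 1) ε q ≤ B + ((n + 1 : ℕ) : ℝ) * ∑ k ∈ K, e k q := by
    intro q
    by_cases hq : ∀ k ∈ K, a k ≤ countAbove (k / M : ℝ) q
    · have := storeyMax_le_of_grid hs hη0 hη1 hM hε hMε q fun k hk hk' =>
        hq k (Finset.mem_filter.2 ⟨hk, hk'⟩)
      have h2 : 0 ≤ ((n + 1 : ℕ) : ℝ) * ∑ k ∈ K, e k q :=
        mul_nonneg (by positivity) (Finset.sum_nonneg fun k _ => he0 k q)
      linarith
    · push Not at hq
      obtain ⟨k, hk, hkq⟩ := hq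
      have h1 : 1 ≤ e k q := by
        rw [he]; dsimp only
        rw [← Real.exp_add]
        refine Real.one_le_exp ?_
        nlinarith
      have h2 : e k q ≤ ∑ k ∈ K, e k q :=
        Finset.single_le_sum (f := fun k => e k q) (fun k _ => he0 k q) hk
      have h3 := storeyMax_le_card (by omega) hε q
      have h4 : (0 : ℝ) < ((n + 1 : ℕ) : ℝ) := by positivity
      nlinarith
  have hint : ∀ k, Integrable (e k) (leastFavorable (n + 1)) := by
    intro k
    refine Integrable.const_mul ?_ _
    refine Integrable.of_bound (C := 1) ?_ (Filter.Eventually.of_forall fun q => ?_)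
    · exact (Real.measurable_exp.comp
        ((measurable_countAbove _).const_mul _)).aestronglyMeasurable
    · rw [Real.norm_of_nonneg (Real.exp_pos _).le, Real.exp_le_one_iff]
      nlinarith [countAbove_nonneg (k / M : ℝ) q]
  have hbound : ∀ k ∈ K, ∫ q, e k q ∂(leastFavorable (n + 1)) ≤
      Real.exp (-((((n + 1 : ℕ) : ℝ) - 1) * ε * η ^ 2 / 8)) := by
    intro k hk
    obtain ⟨hk1, hk2⟩ := Finset.mem_filter.1 hk
    have hk0 : (0 : ℝ) < k := by exact_mod_cast (Finset.mem_Icc.1 hk1).1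
    rw [he]; dsimp only
    rw [integral_const_mul]
    refine (mul_le_mul_of_nonneg_left (integral_exp_neg_countAbove_le n (by positivity)
      (by linarith) (by positivity) (by linarith)) (Real.exp_pos _).le).trans ?_
    rw [← Real.exp_add, Real.exp_le_exp, ha, ht]
    push_cast
    have : (n : ℝ) * η ^ 2 * (ε / 2) ≤ n * η ^ 2 * (1 - k / M) :=
      mul_le_mul_of_nonneg_left (by linarith) (by positivity)
    linarith
  rw [storeyFactor]
  calc _ ≤ ∫ q, (B + ((n + 1 : ℕ) : ℝ) * ∑ k ∈ K, e k q) ∂(leastFavorable (n + 1)) := by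
        -- Only the dominating function has to be integrable, so measurability of `storeyMax` is
        -- never needed.
        refine integral_mono_of_nonneg (Filter.Eventually.of_forall fun q => ?_)
          ((integrable_const _).add ((integrable_finsetSum _ fun k _ => hint k).const_mul _))
          (Filter.Eventually.of_forall hle)
        exact zero_le_one.trans (le_max_left _ _)
    _ = B + ((n + 1 : ℕ) : ℝ) * ∑ k ∈ K, ∫ q, e k q ∂(leastFavorable (n + 1)) := by
        rw [integral_add (integrable_const _)
          ((integrable_finsetSum _ fun k _ => hint k).const_mul _), integral_const_mul,
          integral_finsetSum _ fun k _ => hint k]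
        simp
    _ ≤ _ := by
        have hc : (K.card : ℝ) ≤ M := by
          have := Finset.card_filter_le (Finset.Icc 1 M) fun k : ℕ => (k : ℝ) / M ≤ 1 - ε / 2
          rw [Nat.card_Icc, Nat.add_sub_cancel] at this
          exact_mod_cast this
        have := Finset.sum_le_card_nsmul K _ _ hbound
        rw [nsmul_eq_mul] at this
        gcongr
        exact this.trans (mul_le_mul_of_nonneg_right hc (Real.exp_pos _).le)

/-! ### The two-group model: oracle quotient and concentration. -/

namespace TwoGroupParam

variable {θ : TwoGroupParam}

lemma F1_le_one (x : ℝ) : θ.F1 x ≤ 1 := cdf_le_one _ x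

lemma cdf_one_eq_one_of_Icc {μ : Measure ℝ} [IsProbabilityMeasure μ]
    (h : μ (Set.Icc 0 1) = 1) : cdf μ 1 = 1 := by
  rw [cdf_eq_real, Measure.real]
  have : μ (Set.Iic 1) = 1 :=
    le_antisymm prob_le_one (h ▸ measure_mono fun x hx => hx.2)
  simp [this]

/-- Continuity rules out an atom at l, so weak and strict exceedance have the same probability. -/
lemma real_Ici_eq_of_continuous_cdf {μ : Measure ℝ} [IsProbabilityMeasure μ]
    (h : Continuous (cdf μ)) (l : ℝ) : μ.real (Set.Ici l) = 1 - cdf μ l := by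
  have hs : μ {l} = 0 := by
    rw [← measure_cdf μ, StieltjesFunction.measure_singleton,
      h.continuousAt.continuousWithinAt.leftLim_eq]
    simp
  have h1 : μ.real (Set.Ioi l) = 1 - cdf μ l := by
    rw [cdf_eq_real, ← Set.compl_Iic, measureReal_compl measurableSet_Iic]
    simp
  rw [← h1]
  exact measureReal_congr (Ioi_ae_eq_Ici' hs).symm

namespace MemThetaSuperUnif

lemma F_one (hθ : θ.MemThetaSuperUnif) : θ.F 1 = 1 := by
  rw [F, F0, F1, cdf_one_eq_one_of_Icc hθ.null_supp, cdf_one_eq_one_of_Icc hθ.alt_supp]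
  ring

/-- Super-uniformity keeps the oracle quotients above `pi0` > 0. Hence `pi0Star` is positive, and a
sequence `pilow` tending to 0 eventually drops below it. -/
lemma pi0_mul_le_one_sub_F (hθ : θ.MemThetaSuperUnif) {l : ℝ} (hl : l ∈ Set.Icc (0 : ℝ) 1) :
    θ.pi0 * (1 - l) ≤ 1 - θ.F l := by
  have h1 := hθ.super_unif l hl
  have h2 := F1_le_one (θ := θ) l
  have h3 := hθ.pi0_pos
  have h4 := hθ.pi0_le_one
  rw [F]
  nlinarith

lemma pi0_le_quotient (hθ : θ.MemThetaSuperUnif) (l : Set.Ico (0 : ℝ) 1) :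
    θ.pi0 ≤ (1 - θ.F l) / (1 - (l : ℝ)) := by
  rw [le_div_iff₀ (by linarith [l.2.2])]
  exact hθ.pi0_mul_le_one_sub_F ⟨l.2.1, l.2.2.le⟩

lemma bddBelow_quotient (hθ : θ.MemThetaSuperUnif) :
    BddBelow (Set.range fun l : Set.Ico (0 : ℝ) 1 => (1 - θ.F l) / (1 - (l : ℝ))) :=
  ⟨θ.pi0, by rintro _ ⟨l, rfl⟩; exact hθ.pi0_le_quotient l⟩

lemma pi0Star_pos (hθ : θ.MemThetaSuperUnif) : 0 < θ.pi0Star := by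
  have : Nonempty (Set.Ico (0 : ℝ) 1) := ⟨⟨0, by simp⟩⟩
  exact hθ.pi0_pos.trans_le (le_ciInf hθ.pi0_le_quotient)

lemma F_nonneg (hθ : θ.MemThetaSuperUnif) (x : ℝ) : 0 ≤ θ.F x :=
  add_nonneg (mul_nonneg hθ.pi0_pos.le (cdf_nonneg _ x))
    (mul_nonneg (by linarith [hθ.pi0_le_one]) (cdf_nonneg _ x))

lemma pi0Star_le_one (hθ : θ.MemThetaSuperUnif) : θ.pi0Star ≤ 1 := by
  refine (ciInf_le hθ.bddBelow_quotient ⟨0, by simp⟩).trans ?_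
  simpa using hθ.F_nonneg 0

/-- Restricting the oracle infimum to `[0, 1 - ε]` costs at most a multiple of `ε`. -/
lemma exists_quotient_le (hθ : θ.MemThetaSuperUnif) :
    ∃ K : ℝ, ∀ ε : ℝ, 0 < ε → ε < 1 → ∃ l, 0 ≤ l ∧ l ≤ 1 - ε ∧
      (1 - θ.F l) / (1 - l) ≤ θ.pi0Star + K * ε := by
  obtain ⟨f, ⟨L, hL⟩, -, hF⟩ := hθ.lipschitz_density
  have hfi : ∀ x ∈ Set.Icc (0 : ℝ) 1, ∀ y ∈ Set.Icc (0 : ℝ) 1,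
      IntervalIntegrable f volume x y := fun x hx y hy =>
    (hL.continuousOn.mono (Set.uIcc_subset_Icc hx hy)).intervalIntegrable
  have h0 : (0 : ℝ) ∈ Set.Icc (0 : ℝ) 1 := by simp
  have h1 : (1 : ℝ) ∈ Set.Icc (0 : ℝ) 1 := by simp
  -- The quotient at x is the mean of f over [x, 1], hence close to f 1.
  have hquot : ∀ ε x : ℝ, ε ≤ 1 → 1 - ε ≤ x → x < 1 →
      |(1 - θ.F x) / (1 - x) - f 1| ≤ L * ε := by
    intro ε x hε hx hx1
    have hxm : x ∈ Set.Icc (0 : ℝ) 1 := ⟨by linarith, hx1.le⟩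
    have hd : 1 - θ.F x = ∫ t in x..1, f t := by
      have h := intervalIntegral.integral_interval_sub_left (hfi 0 h0 1 h1) (hfi 0 h0 x hxm)
      rwa [← hF 1 h1, ← hF x hxm, hθ.F_one] at h
    have hb : ‖∫ t in x..1, (f t - f 1)‖ ≤ L * ε * |1 - x| := by
      refine intervalIntegral.norm_integral_le_of_norm_le_const fun t ht => ?_
      rw [Set.uIoc_of_le hx1.le] at ht
      have := hL.dist_le_mul t ⟨by linarith [ht.1], ht.2⟩ 1 h1
      rw [Real.dist_eq, Real.dist_eq] at this
      rw [Real.norm_eq_abs]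
      refine this.trans (mul_le_mul_of_nonneg_left ?_ L.2)
      rw [abs_le]; constructor <;> linarith [ht.1, ht.2]
    rw [intervalIntegral.integral_sub (hfi x hxm 1 h1) (by simp), ← hd,
      intervalIntegral.integral_const, smul_eq_mul, abs_of_pos (sub_pos.2 hx1),
      Real.norm_eq_abs] at hb
    have hx0 : 0 < 1 - x := by linarith
    have he : (1 - θ.F x) / (1 - x) - f 1 = (1 - θ.F x - (1 - x) * f 1) / (1 - x) := by
      field_simp
    rw [he, abs_div, abs_of_pos hx0, div_le_iff₀ hx0]
    exact hb
  -- One ε pays for a near-minimiser, as the infimum need not be attained; 2Lε pays for moving it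
  -- back to 1 - ε, comparing both quotients with f 1.
  refine ⟨1 + 2 * L, fun ε hε0 hε1 => ?_⟩
  have : Nonempty (Set.Ico (0 : ℝ) 1) := ⟨⟨0, by simp⟩⟩
  obtain ⟨⟨l, hl0, hl1⟩, hl⟩ := exists_lt_of_ciInf_lt
    (show θ.pi0Star < θ.pi0Star + ε by linarith)
  have hLε : 0 ≤ (L : ℝ) * ε := by positivity
  by_cases hlε : l ≤ 1 - ε
  · exact ⟨l, hl0, hlε, by dsimp only at hl; linarith⟩
  · push Not at hlε
    refine ⟨1 - ε, by linarith, le_rfl, ?_⟩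
    have ha := (abs_le.1 (hquot ε (1 - ε) hε1.le le_rfl (by linarith))).2
    have hb := (abs_le.1 (hquot ε l hε1.le hlε.le hl1)).1
    dsimp only at hl
    linarith

lemma isProbabilityMeasure_pairLaw (hθ : θ.MemThetaSuperUnif) :
    IsProbabilityMeasure θ.pairLaw := by
  constructor
  rw [pairLaw]
  simp only [Measure.add_apply, Measure.smul_apply, measure_univ, smul_eq_mul, mul_one]
  rw [← ENNReal.ofReal_add hθ.pi0_pos.le (by linarith [hθ.pi0_le_one])]
  simp

lemma integral_pairLaw_ite (hθ : θ.MemThetaSuperUnif) (l : ℝ) :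
    ∫ x, (if l ≤ x.2 then (1 : ℝ) else 0) ∂θ.pairLaw = 1 - θ.F l := by
  have hm : Measurable fun x : Bool × ℝ => if l ≤ x.2 then (1 : ℝ) else 0 :=
    Measurable.ite (measurableSet_le measurable_const measurable_snd) measurable_const
      measurable_const
  have hi : ∀ ν : Measure (Bool × ℝ), IsFiniteMeasure ν →
      Integrable (fun x : Bool × ℝ => if l ≤ x.2 then (1 : ℝ) else 0) ν := by
    intro ν _
    refine Integrable.of_bound (C := 1) hm.aestronglyMeasurable
      (Filter.Eventually.of_forall fun x => ?_)
    split_ifs <;> simp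
  have hp : ∀ (b : Bool) (ν : Measure ℝ) [IsProbabilityMeasure ν], Continuous (cdf ν) →
      ∫ x, (if l ≤ x.2 then (1 : ℝ) else 0) ∂((Measure.dirac b).prod ν) = 1 - cdf ν l := by
    intro b ν _ hν
    rw [Measure.dirac_prod, integral_map measurable_prodMk_left.aemeasurable
      hm.aestronglyMeasurable, ← real_Ici_eq_of_continuous_cdf hν l,
      ← integral_indicator_one measurableSet_Ici]
    congr 1
  rw [pairLaw, integral_add_measure ((hi _ inferInstance).smul_measure ENNReal.ofReal_ne_top)
    ((hi _ inferInstance).smul_measure ENNReal.ofReal_ne_top), integral_smul_measure,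
    integral_smul_measure, hp _ _ hθ.null_cont, hp _ _ hθ.alt_cont,
    ENNReal.toReal_ofReal hθ.pi0_pos.le, ENNReal.toReal_ofReal (by linarith [hθ.pi0_le_one]),
    F, F0, F1, smul_eq_mul, smul_eq_mul]
  ring

/-- Hoeffding's inequality for the number of p-values that are at least `l`. -/
lemma law_real_count_ge_le (hθ : θ.MemThetaSuperUnif) (m : ℕ) (l : ℝ) {τ : ℝ} (hτ : 0 ≤ τ) :
    (θ.law m).real {ω | m * (1 - θ.F l + τ) ≤ ∑ i, if l ≤ (ω i).2 then (1 : ℝ) else 0} ≤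
      Real.exp (-(2 * m * τ ^ 2)) := by
  have := hθ.isProbabilityMeasure_pairLaw
  have hm : Measurable fun x : Bool × ℝ => if l ≤ x.2 then (1 : ℝ) else 0 :=
    Measurable.ite (measurableSet_le measurable_const measurable_snd) measurable_const
      measurable_const
  set X : Fin m → (Fin m → Bool × ℝ) → ℝ := fun i ω =>
    (if l ≤ (ω i).2 then (1 : ℝ) else 0) - (1 - θ.F l) with hX
  have hind : iIndepFun X (θ.law m) :=
    iIndepFun_pi (X := fun _ (x : Bool × ℝ) => (if l ≤ x.2 then (1 : ℝ) else 0) - (1 - θ.F l))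
      fun i => (hm.sub_const _).aemeasurable
  have hlaw : IsProbabilityMeasure (θ.law m) := by unfold law; infer_instance
  have hsub : ∀ i ∈ (Finset.univ : Finset (Fin m)),
      HasSubgaussianMGF (X i) ((‖(1 : ℝ) - 0‖₊ / 2) ^ 2) (θ.law m) := by
    intro i _
    have hmi := hm.comp (measurable_pi_apply (X := fun _ : Fin m => Bool × ℝ) i)
    have h := hasSubgaussianMGF_of_mem_Icc (μ := θ.law m) (a := 0) (b := 1) hmi.aemeasurable
      (Filter.Eventually.of_forall fun ω => by
        simp only [Function.comp]; split_ifs <;> simp)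
    have hmean : ∫ ω, ((fun x : Bool × ℝ => if l ≤ x.2 then (1 : ℝ) else 0) ∘
        fun ω : Fin m → Bool × ℝ => ω i) ω ∂(θ.law m) = 1 - θ.F l := by
      rw [← hθ.integral_pairLaw_ite l]
      exact integral_comp_eval (μ := fun _ : Fin m => θ.pairLaw) hm.aestronglyMeasurable
    rw [hmean] at h
    exact h
  have h := HasSubgaussianMGF.measure_sum_ge_le_of_iIndepFun hind hsub
    (ε := m * τ) (by positivity)
  have hset : {ω : Fin m → Bool × ℝ | m * (1 - θ.F l + τ) ≤
      ∑ i, if l ≤ (ω i).2 then (1 : ℝ) else 0} = {ω | m * τ ≤ ∑ i, X i ω} := by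
    ext ω
    simp only [hX, Set.mem_ofPred_eq, Finset.sum_sub_distrib, Finset.sum_const,
      Finset.card_univ, Fintype.card_fin, nsmul_eq_mul]
    constructor <;> intro h <;> linarith
  rw [hset]
  refine h.trans (Real.exp_le_exp.2 (le_of_eq ?_))
  rcases Nat.eq_zero_or_pos m with rfl | hm0
  · simp
  have : (m : ℝ) ≠ 0 := by positivity
  simp
  field_simp

end MemThetaSuperUnif
end TwoGroupParam

/-! ### Choice of scales and conclusion. -/

/-- `storeyFactor_le` is applied with grid size m and η = ε = δ. The lower bound on `pilow` forces s
≥ m / log m, so the Chernoff term is at most m⁻³ and survives the prefactor s·m ≤ m². -/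
lemma normFactor_le {m : ℕ} {δ pilow : ℝ} (hm : 0 < m) (hδ : 0 < δ) (hmδ : m * δ ^ 4 = 1)
    (hlog : 2 ≤ Real.log m) (hlogδ : 49 * Real.log m ^ 2 * δ ≤ 1)
    (hlow : min (1 / 2 : ℝ) (162 / Real.log m) ≤ pilow) :
    normFactor m δ pilow ≤ 1 + 5 * δ := by
  have hm' : (0 : ℝ) < m := by exact_mod_cast hm
  set Λ := Real.log m with hΛ
  have hδ1 : δ ≤ 1 / 196 := by
    have : 4 * δ ≤ Real.log m ^ 2 * δ :=
      mul_le_mul_of_nonneg_right (by nlinarith) hδ.le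
    linarith
  have hδ2 : δ ^ 2 ≤ δ := by nlinarith
  have hδ3 : δ ^ 3 ≤ δ := by nlinarith
  have hδ4 : δ ^ 4 ≤ δ / 2 := by nlinarith
  have hminv : 1 / (m : ℝ) = δ ^ 4 := by rw [div_eq_iff hm'.ne']; linarith
  -- The nonnegativity of the bound covers an empty range of s, where `sSup` is 0.
  refine Real.sSup_le ?_ (by positivity)
  rintro _ ⟨s, ⟨hs1, hsl, hsm⟩, rfl⟩
  have hsm' : (s : ℝ) ≤ m := by exact_mod_cast hsm
  have hms : (m : ℝ) ≤ s * Λ := by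
    have h1 : 1 / Λ ≤ min (1 / 2 : ℝ) (162 / Λ) :=
      le_min (one_div_le_one_div_of_le (by norm_num) hlog) (by gcongr; norm_num)
    have h2 : 1 / Λ * m ≤ s := (mul_le_mul_of_nonneg_right (h1.trans hlow) hm'.le).trans hsl
    rw [div_mul_eq_mul_div, div_le_iff₀ (by linarith)] at h2
    linarith
  have hs0 : (0 : ℝ) < s := by exact_mod_cast hs1
  -- 48 = 3·8·2: exponent 3Λ, the 8 of the Chernoff bound, and s ≤ 2(s - 1).
  have h48 : 48 * Λ ≤ s * δ ^ 3 := by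
    have h1 : 1 ≤ s * Λ * δ ^ 4 := hmδ ▸ mul_le_mul_of_nonneg_right hms (by positivity)
    refine le_of_mul_le_mul_right ?_ (mul_pos (by linarith : 0 < Λ) hδ)
    nlinarith
  have hsδ : 1 ≤ s * δ := by nlinarith
  have hs2 : 2 ≤ s := by
    have : (2 : ℝ) ≤ s := by nlinarith
    exact_mod_cast this
  have hs2' : (2 : ℝ) ≤ s := by exact_mod_cast hs2
  refine (storeyFactor_le hs2 hδ.le (by linarith) hm hδ (by rw [hminv]; exact hδ4)).trans ?_
  have hinv : 1 / (s : ℝ) ≤ δ := by rw [div_le_iff₀ hs0]; linarith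
  have hinv' : 1 / (m * δ) = δ ^ 3 := by
    rw [div_eq_iff (by positivity)]; linarith
  have hD : 1 - 3 * δ ≤ (1 - δ) * (1 - 1 / s) * (1 - 1 / (m * δ)) := by
    rw [hinv']
    have h1 : (1 - δ) * (1 - δ) ≤ (1 - δ) * (1 - 1 / s) :=
      mul_le_mul_of_nonneg_left (by linarith) (by linarith)
    have h2 : (1 - δ) * (1 - δ) * (1 - δ) ≤ (1 - δ) * (1 - 1 / s) * (1 - δ ^ 3) :=
      mul_le_mul h1 (by linarith) (by linarith) (mul_nonneg (by linarith) (by linarith))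
    nlinarith
  have hB : 1 / ((1 - δ) * (1 - 1 / s) * (1 - 1 / (m * δ))) ≤ 1 + 4 * δ := by
    rw [div_le_iff₀ (by linarith)]
    nlinarith
  have hE : Real.exp (-((s - 1) * δ * δ ^ 2 / 8)) ≤ δ ^ 12 := by
    have h1 : 3 * Λ ≤ (s - 1) * δ * δ ^ 2 / 8 := by
      have : s * δ ^ 3 ≤ 2 * (s - 1) * δ ^ 3 :=
        mul_le_mul_of_nonneg_right (by linarith) (by positivity)
      linarith
    have h2 : Real.exp (-(3 * Λ)) = δ ^ 12 := by
      rw [Real.exp_neg, show 3 * Λ = ((3 : ℕ) : ℝ) * Λ by norm_num, Real.exp_nat_mul, hΛ,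
        Real.exp_log hm', ← inv_pow, ← one_div, hminv]
      ring
    rw [← h2]
    exact Real.exp_le_exp.2 (by linarith)
  have hT : s * (m * Real.exp (-((s - 1) * δ * δ ^ 2 / 8))) ≤ δ := by
    calc _ ≤ (m : ℝ) * (m * δ ^ 12) := by gcongr
      _ = (m * δ ^ 4) ^ 2 * δ ^ 4 := by ring
      _ ≤ δ := by rw [hmδ]; linarith
  linarith

/-- If few p-values lie above `l`, then the Minimum-Storey estimator is close to the oracle. -/
lemma msEstimator_lt {m : ℕ} {δ r K pilow π G A l : ℝ} {p : Fin m → ℝ} (hm : 0 < m)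
    (hδ : 0 < δ) (hmδ : m * δ ^ 4 = 1) (hδ1 : δ ≤ 1) (hC : normFactor m δ pilow ≤ 1 + 5 * δ)
    (hK : K * δ ≤ r) (h20 : 20 * δ ≤ r) (hr : r ≤ 1) (hπ1 : π ≤ 1)
    (hpilow : pilow < π) (hl0 : 0 ≤ l) (hl1 : l ≤ 1 - δ)
    (hG : G = A / (1 - l)) (hGπ : G ≤ π + K * δ)
    (hp : ∑ i, (if l ≤ p i then (1 : ℝ) else 0) < m * (A + r * δ)) :
    msEstimator m δ pilow p < π + 4 * r := by
  have hm' : (0 : ℝ) < m := by exact_mod_cast hm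
  have hl : 0 < 1 - l := by linarith
  set N := ∑ i, (if l ≤ p i then (1 : ℝ) else 0) with hN
  have hN0 : 0 ≤ N := Finset.sum_nonneg fun i _ => by split_ifs <;> norm_num
  refine max_lt (by linarith) ?_
  set I := ⨅ l : Set.Icc (0 : ℝ) (1 - δ),
      max 1 (∑ i : Fin m, if (l : ℝ) ≤ p i then (1 : ℝ) else 0) / (m * (1 - (l : ℝ))) with hI
  have hnn : ∀ x : Set.Icc (0 : ℝ) (1 - δ), 0 ≤
      max 1 (∑ i : Fin m, if (x : ℝ) ≤ p i then (1 : ℝ) else 0) / (m * (1 - (x : ℝ))) := fun x =>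
    div_nonneg (zero_le_one.trans (le_max_left _ _))
      (mul_nonneg hm'.le (by linarith [x.2.2]))
  have hI0 : 0 ≤ I := Real.iInf_nonneg hnn
  have hI1 : I ≤ G + r + δ := by
    refine (ciInf_le ⟨0, by rintro _ ⟨x, rfl⟩; exact hnn x⟩ ⟨l, hl0, hl1⟩).trans ?_
    dsimp only
    rw [div_le_iff₀ (mul_pos hm' hl)]
    have hA : (1 - l) * G = A := by rw [hG]; field_simp
    -- The summand δ in the bound on I absorbs the truncation `max 1` of the count.
    have h1 : 1 ≤ m * (1 - l) * δ := by
      have h2 : m * δ ^ 4 ≤ m * δ ^ 2 :=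
        mul_le_mul_of_nonneg_left (pow_le_pow_of_le_one hδ.le hδ1 (by norm_num)) hm'.le
      have h3 : m * δ * δ ≤ m * δ * (1 - l) :=
        mul_le_mul_of_nonneg_left (by linarith) (by positivity)
      nlinarith
    have h4 : m * r * δ ≤ m * r * (1 - l) :=
      mul_le_mul_of_nonneg_left (by linarith) (mul_nonneg hm'.le (by linarith))
    have h5 : (G + r + δ) * (m * (1 - l)) = m * A + m * r * (1 - l) + m * (1 - l) * δ := by
      rw [← hA]; ring
    rw [h5]
    refine max_le ?_ ?_ <;> linarith
  have h1 : normFactor m δ pilow * I ≤ (1 + 5 * δ) * I := mul_le_mul_of_nonneg_right hC hI0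
  -- I ≤ π + Kδ + r + δ, four terms each at most 1. The total excess Kδ + r + δ + 20δ is then below
  -- 4r.
  have h2 : 5 * δ * I ≤ 5 * δ * 4 := mul_le_mul_of_nonneg_left (by linarith) (by positivity)
  linarith

/-- Squares the eventual bound log m ≤ m^(1/8) / 7. -/
lemma eventually_log_sq_mul_rpow_le :
    ∀ᶠ m : ℕ in atTop, 49 * Real.log m ^ 2 * (m : ℝ) ^ (-(1 / 4) : ℝ) ≤ 1 := by
  have h := ((isLittleO_log_rpow_atTop (by norm_num : (0 : ℝ) < 1 / 8)).bound
    (by norm_num : (0 : ℝ) < 1 / 7)).and (eventually_ge_atTop 1)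
  filter_upwards [tendsto_natCast_atTop_atTop.eventually h] with m ⟨hm, hm1⟩
  have hm0 : (0 : ℝ) < m := by linarith
  rw [Real.norm_of_nonneg (Real.log_nonneg hm1), Real.norm_of_nonneg (by positivity)] at hm
  have h2 : Real.log m ^ 2 ≤ (1 / 7 * (m : ℝ) ^ (1 / 8 : ℝ)) ^ 2 :=
    pow_le_pow_left₀ (Real.log_nonneg hm1) hm 2
  have h3 : ((m : ℝ) ^ (1 / 8 : ℝ)) ^ 2 = (m : ℝ) ^ (1 / 4 : ℝ) := by
    rw [← Real.rpow_natCast, ← Real.rpow_mul hm0.le]; norm_num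
  rw [mul_pow, h3] at h2
  rw [Real.rpow_neg hm0.le, mul_inv_le_iff₀ (by positivity)]
  linarith

theorem proposition5p3 (θ : TwoGroupParam) (hθ : θ.MemThetaSuperUnif) (pilow : ℕ → ℝ)
    (hlow : ∀ᶠ m : ℕ in atTop, min (1 / 2 : ℝ) (162 / Real.log m) ≤ pilow m)
    (hlim : Tendsto pilow atTop (𝓝 0)) :
    ∀ᶠ m : ℕ in atTop,
      (θ.law m).real {ω | θ.pi0Star + 4 * (Real.sqrt (Real.log m) / (m : ℝ) ^ (1 / 4 : ℝ)) ≤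
        msEstimator m ((m : ℝ) ^ (-(1 / 4) : ℝ)) (pilow m) (fun i => (ω i).2)} ≤ 1 / (m : ℝ) := by
  obtain ⟨K, hK⟩ := hθ.exists_quotient_le
  have hlogtop : Tendsto (fun m : ℕ => Real.log m) atTop atTop :=
    Real.tendsto_log_atTop.comp tendsto_natCast_atTop_atTop
  have hsqrttop := Real.tendsto_sqrt_atTop.comp hlogtop
  filter_upwards [hlow, hlim.eventually_lt_const hθ.pi0Star_pos,
    eventually_log_sq_mul_rpow_le, hlogtop.eventually_ge_atTop 2,
    -- K comes from the Lipschitz constant, so this threshold on m depends on θ.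
    hsqrttop.eventually_ge_atTop (max K 20), eventually_gt_atTop 0]
    with m hlow hpilow hlogδ hlog hsqrt hm
  have hm' : (0 : ℝ) < m := by exact_mod_cast hm
  simp only [Function.comp] at hsqrt
  set δ := (m : ℝ) ^ (-(1 / 4) : ℝ) with hδdef
  have hδ : 0 < δ := by positivity
  have hmδ : m * δ ^ 4 = 1 := by
    rw [hδdef, ← Real.rpow_natCast, ← Real.rpow_mul hm'.le]
    norm_num
    rw [Real.rpow_neg_one, mul_inv_cancel₀ hm'.ne']
  have hδ1 : δ ≤ 1 / 196 := by
    have : 4 * δ ≤ Real.log m ^ 2 * δ :=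
      mul_le_mul_of_nonneg_right (by nlinarith) hδ.le
    linarith
  have hdiv : Real.sqrt (Real.log m) / (m : ℝ) ^ (1 / 4 : ℝ) = Real.sqrt (Real.log m) * δ := by
    rw [hδdef, Real.rpow_neg hm'.le, div_eq_mul_inv]
  set r := Real.sqrt (Real.log m) * δ with hr
  rw [hdiv]
  have hr0 : 0 ≤ r := by positivity
  have hr1 : r ≤ 1 := by
    have h1 : Real.sqrt (Real.log m) ≤ Real.log m ^ 2 :=
      Real.sqrt_le_iff.2 ⟨by positivity, by
        rw [← pow_mul]; exact le_self_pow₀ (by linarith) (by norm_num)⟩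
    have h2 : r ≤ Real.log m ^ 2 * δ := mul_le_mul_of_nonneg_right h1 hδ.le
    linarith
  obtain ⟨l, hl0, hl1, hG⟩ := hK δ hδ (by linarith)
  have hprob : IsProbabilityMeasure (θ.law m) := by
    have := hθ.isProbabilityMeasure_pairLaw
    unfold TwoGroupParam.law
    infer_instance
  have hsub : {ω : Fin m → Bool × ℝ | θ.pi0Star + 4 * r ≤
      msEstimator m δ (pilow m) (fun i => (ω i).2)} ⊆ {ω | m * (1 - θ.F l + r * δ) ≤
        ∑ i, if l ≤ (ω i).2 then (1 : ℝ) else 0} := by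
    intro ω hω
    rw [Set.mem_ofPred_eq] at hω ⊢
    by_contra hcon
    refine hω.not_gt (msEstimator_lt hm hδ hmδ (by linarith)
      (normFactor_le hm hδ hmδ hlog hlogδ hlow)
      (mul_le_mul_of_nonneg_right ((le_max_left _ _).trans hsqrt) hδ.le)
      (mul_le_mul_of_nonneg_right ((le_max_right _ _).trans hsqrt) hδ.le)
      hr1 hθ.pi0Star_le_one hpilow hl0 hl1 rfl hG (not_le.1 hcon))
  refine (measureReal_mono hsub).trans
    ((hθ.law_real_count_ge_le m l (by positivity)).trans ?_)
  -- The Hoeffding bound is thus m⁻², more than the required 1/m.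
  have h1 : 2 * m * (r * δ) ^ 2 = 2 * Real.log m := by
    have : Real.sqrt (Real.log m) ^ 2 = Real.log m := Real.sq_sqrt (by linarith)
    calc 2 * m * (r * δ) ^ 2 = 2 * Real.sqrt (Real.log m) ^ 2 * (m * δ ^ 4) := by rw [hr]; ring
      _ = _ := by rw [this, hmδ, mul_one]
  rw [h1, one_div, ← Real.exp_log (inv_pos.2 hm'), Real.log_inv]
  exact Real.exp_le_exp.2 (by linarith)
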